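/- **Setting.** For every sample size $n$ (all sufficiently large $n$) consider a Gaussian linear model $\mathbf y=\mathbf X\boldsymbol\beta+\mathbf w\in\mathbb R^n$, where the design matrix $\mathbf X=[\mathbf x_1,\dots,\mathbf x_p]\in\mathbb R^{n\times p}$ is deterministic with full column rank $p$ and $1\le p<n$, $\boldsymbol\beta\in\mathbb R^p$ is non-zero, and $\mathbf w\sim\mathcal N(\mathbf 0,\sigma^2\mathbf I_n)$ with $\sigma>0$; the quantities $p,\mathbf X,\boldsymbol\beta,\sigma$ may all depend on $n$. The model order is $k_0=\max\{k:\boldsymbol\beta_k\ne0\}\in\{1,\dots,p\}$. For $0\le k\le p$ let $\mathbf P_k$ be the orthogonal projection of $\mathbb R^n$ onto $\mathrm{span}(\mathbf x_1,\dots,\mathbf x_k)$ (so $\mathbf P_0=0$), and for $1\le k\le p$ let $$RR(k)=\frac{\|(\mathbf I_n-\mathbf P_k)\mathbf y\|_2^2}{\|(\mathbf I_n-\mathbf P_{k-1})\mathbf y\|_2^2},\qquad \Gamma^{\alpha}(k)=F^{-1}_{\frac{n-k}{2},\frac12}\!\left(\frac{\alpha}{p}\right)\quad(0\le\alpha\le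 p),$$ where $F^{-1}_{a,b}$ is the inverse cumulative distribution function of the $\mathrm{Beta}(a,b)$ distribution. The residual ratio thresholding (RRT) estimate with parameter $\alpha$ is $\hat k=\max\{k\in\{1,\dots,p\}:RR(k)\le\Gamma^{\alpha}(k)\}$ if this set is non-empty; otherwise $\hat k=\max\{k\in\{1,\dots,p\}:RR(k)\le\Gamma^{\alpha_{new}}(k)\}$, where $\alpha_{new}$ is the least $a\in(\alpha,p]$ such that $\{k:RR(k)\le\Gamma^{a}(k)\}\neq\emptyset$. Write $PCS=\mathbb P(\hat k=k_0)$, $\mathbb P_{\mathcal U}=\mathbb P(\hat k<k_0)$ and $\mathbb P_{\mathcal O}=\mathbb P(\hat k>k_0)$. **Theorem.** Let $n\to\infty$ such that a) $k_0/n\to k_{lim}$ with $0\le k_{lim}<1$; and b) there are $M_1>0$ and $n_0<\infty$ with $\|(\mathbf I_n-\mathbf P_{k_0-1})\mathbf x_{k_0}\|_2^2\,|\boldsymbol\beta_{k_0}|^2/\sigma^2\ge M_1n$ for all $n>n_0$. Then: R1) If $\alpha=\alpha(n)>0$ is deterministic and satisfies $\log(\alpha)/n\to0$ and $\alpha\to0$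 as $n\to\infty$, then RRT with parameter $\alpha$ is large sample consistent, i.e. $PCS\to1$. R2) For every fixed $0<\alpha\le1$, RRT with parameter $\alpha$ satisfies $\lim_{n\to\infty}\mathbb P_{\mathcal U}=0$ and $\limsup_{n\to\infty}\mathbb P_{\mathcal O}\le\alpha$. -/

import Mathlib

noncomputable section

namespace RRT

/-- The `j`-th column of the design matrix, as a vector of the Euclidean space `ℝⁿ`. -/
def column {n p : ℕ} (X : Matrix (Fin n) (Fin p) ℝ) (j : Fin p) : EuclideanSpace ℝ (Fin n) :=
  WithLp.toLp 2 (X.col j)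

/-- The span of the first `k` columns of `X` (column number `j + 1` is `column X j`). -/
def colSpan {n p : ℕ} (X : Matrix (Fin n) (Fin p) ℝ) (k : ℕ) :
    Submodule ℝ (EuclideanSpace ℝ (Fin n)) :=
  Submodule.span ℝ (column X '' {j : Fin p | (j : ℕ) < k})

/-- The residual `(I - P_k) v`, where `P_k` is the orthogonal projection onto the span of the
first `k` columns of `X` (so `P_0 = 0`). -/
def residual {n p : ℕ} (X : Matrix (Fin n) (Fin p) ℝ) (k : ℕ) (v : EuclideanSpace ℝ (Fin n)) :
    EuclideanSpace ℝ (Fin n) :=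
  v - (colSpan X k).starProjection v

/-- The residual ratio `RR(k) = ‖(I - P_k) y‖² / ‖(I - P_{k-1}) y‖²`, used for `k ≥ 1`. -/
def residualRatio {n p : ℕ} (X : Matrix (Fin n) (Fin p) ℝ) (y : EuclideanSpace ℝ (Fin n))
    (k : ℕ) : ℝ :=
  ‖residual X k y‖ ^ 2 / ‖residual X (k - 1) y‖ ^ 2

/-- The inverse CDF of the Beta distribution with parameters `a, b > 0`, at a level
`q ∈ [0, 1]`. The CDF is continuous and strictly increasing on `[0, 1]`, so the infimum is the
unique point of `[0, 1]` where the CDF equals `q`. -/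
def betaInvCDF (a b q : ℝ) : ℝ :=
  sInf {x : ℝ | 0 ≤ x ∧ q ≤ ProbabilityTheory.cdf (ProbabilityTheory.betaMeasure a b) x}

/-- The threshold `Γ^α(k)`: the inverse CDF of `Beta((n - k) / 2, 1 / 2)` at `α / p`
(for `1 ≤ k ≤ p < n` and `0 ≤ α ≤ p`). -/
def threshold (n p : ℕ) (α : ℝ) (k : ℕ) : ℝ :=
  betaInvCDF (((n : ℝ) - (k : ℝ)) / 2) (1 / 2) (α / (p : ℝ))

open Classical in
/-- The set `{k ∈ {1, …, p} : RR(k) ≤ Γ^α(k)}`. -/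
def crossings {n p : ℕ} (X : Matrix (Fin n) (Fin p) ℝ) (y : EuclideanSpace ℝ (Fin n)) (α : ℝ) :
    Finset ℕ :=
  {k ∈ Finset.Icc 1 p | residualRatio X y k ≤ threshold n p α k}

/-- `α_new`: the least `a ∈ (α, p]` for which `{k : RR(k) ≤ Γ^a(k)}` is nonempty. -/
def alphaNew {n p : ℕ} (X : Matrix (Fin n) (Fin p) ℝ) (y : EuclideanSpace ℝ (Fin n)) (α : ℝ) : ℝ :=
  sInf {a : ℝ | α < a ∧ a ≤ (p : ℝ) ∧ (crossings X y a).Nonempty}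

open Classical in
/-- The residual ratio thresholding estimate of the model order: the largest `k` with
`RR(k) ≤ Γ^α(k)`; if there is no such `k`, then `α` is replaced by `α_new`. -/
def estimate {n p : ℕ} (X : Matrix (Fin n) (Fin p) ℝ) (α : ℝ) (y : EuclideanSpace ℝ (Fin n)) : ℕ :=
  if (crossings X y α).Nonempty then (crossings X y α).sup id
  else (crossings X y (alphaNew X y α)).sup id

open Classical in
/-- The model order `k₀ = max {k : β_k ≠ 0}`, with 1-based indices (`0` if `β = 0`). -/
def modelOrder {p : ℕ} (β : Fin p → ℝ) : ℕ :=
  ({j : Fin p | β j ≠ 0} : Finset (Fin p)).sup fun j => (j : ℕ) + 1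

/-- The observation `y = X β + w`. -/
def observation {n p : ℕ} (X : Matrix (Fin n) (Fin p) ℝ) (β : Fin p → ℝ)
    (w : EuclideanSpace ℝ (Fin n)) : EuclideanSpace ℝ (Fin n) :=
  WithLp.toLp 2 (X.mulVec β) + w

/-- The law `N(0, σ² I)` of the noise. -/
def noiseLaw (n : ℕ) (σ : ℝ) : MeasureTheory.Measure (EuclideanSpace ℝ (Fin n)) :=
  ProbabilityTheory.multivariateGaussian 0 ((σ ^ 2) • (1 : Matrix (Fin n) (Fin n) ℝ))

end RRT

end

open MeasureTheory ProbabilityTheory Set Module Filter Topology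
open scoped ENNReal RealInnerProductSpace

namespace RRT

/-! Everything rests on the event that `k₀` is missed, i.e. that `RR(k₀)` exceeds its threshold. Off
this event `k₀` is a crossing, so the estimate is at least `k₀` and the fallback `alphaNew` plays no
role; the estimate then exceeds `k₀` only if some `k > k₀` is a false crossing.

False crossings: for `k > k₀` the signal disappears and `RR(k) = ‖Z‖² / (‖Z‖² + z²)`, with `Z`
standard Gaussian in dimension `n - k` and `z` an independent scalar one, up to a common scale. This
ratio is `Beta((n - k)/2, 1/2)` (`gaussian_ratio_law`, `noiseLaw_map_residualRatio`), so each false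
crossing has probability at most `α/p`, and a union bound gives `α`.

Misses: at `k₀` the numerator is of order at most `nσ²`, while the denominator contains a signal
term of order at least `nσ²`. So `RR(k₀)` stays below some fixed `x < 1` with probability close to 1
(`noiseLaw_lt_residualRatio_le`). The beta distribution function at `x` is at most `x^((n - k₀)/2)
(1 - x)^(-1/2)`, exponentially small because `klim < 1`, whereas `α/p ≥ α/n` decays
subexponentially; hence the threshold eventually exceeds `x` (`eventually_le_threshold`). -/

/-! ### Gaussian integrals in polar coordinates and the beta law of a Gaussian ratio. -/

theorem lintegral_scale_Ioi {a : ℝ} (ha : 0 < a) (h : ℝ → ℝ≥0∞) :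
    ∫⁻ r in Ioi 0, h r = ENNReal.ofReal a * ∫⁻ s in Ioi 0, h (a * s) := by
  have himg : (fun s : ℝ => a * s) '' Ioi 0 = Ioi 0 := by
    rw [image_mul_left_Ioi ha, mul_zero]
  have := lintegral_image_eq_lintegral_abs_deriv_mul (s := Ioi (0 : ℝ)) (f := fun s => a * s)
    (f' := fun _ => a) measurableSet_Ioi
    (fun x _ => (hasDerivAt_const_mul a).hasDerivWithinAt)
    (fun x _ y _ hxy => mul_left_cancel₀ ha.ne' hxy) h
  rw [himg] at this
  rw [this, lintegral_const_mul' _ _ ENNReal.ofReal_ne_top, abs_of_pos ha]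

theorem lintegral_scale {a : ℝ} (ha : 0 < a) (h : ℝ → ℝ≥0∞) :
    ∫⁻ r, h r = ENNReal.ofReal a * ∫⁻ s, h (a * s) := by
  have himg : (fun s : ℝ => a * s) '' univ = univ := by
    rw [image_univ]
    exact (mul_left_surjective₀ ha.ne').range_eq
  have := lintegral_image_eq_lintegral_abs_deriv_mul (s := (univ : Set ℝ)) (f := fun s => a * s)
    (f' := fun _ => a) MeasurableSet.univ
    (fun x _ => (hasDerivAt_const_mul a).hasDerivWithinAt)
    (fun x _ y _ hxy => mul_left_cancel₀ ha.ne' hxy) h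
  rw [himg, Measure.restrict_univ] at this
  rw [this, lintegral_const_mul' _ _ ENNReal.ofReal_ne_top, abs_of_pos ha]

section

variable {E : Type*} [NormedAddCommGroup E] [InnerProductSpace ℝ E] [FiniteDimensional ℝ E]
  [MeasurableSpace E] [BorelSpace E]

/-- Polar coordinates on the punctured space, the origin being null; with values in `ℝ≥0∞` no
integrability is needed. -/
theorem lintegral_fun_norm [Nontrivial E] {f : ℝ → ℝ≥0∞} (hf : Measurable f) :
    ∫⁻ x : E, f ‖x‖ = (volume : Measure E).toSphere univ *
      ∫⁻ r in Ioi 0, ENNReal.ofReal (r ^ (finrank ℝ E - 1)) * f r := by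
  calc ∫⁻ x : E, f ‖x‖
      = ∫⁻ x : ({(0)}ᶜ : Set E), f ‖x.1‖ ∂((volume : Measure E).comap Subtype.val) := by
        rw [lintegral_subtype_comap (measurableSet_singleton _).compl fun x : E => f ‖x‖,
          restrict_compl_singleton]
    _ = ∫⁻ x, f x.2 ∂(volume : Measure E).toSphere.prod (.volumeIoiPow (finrank ℝ E - 1)) := by
        simpa using ((volume : Measure E).measurePreserving_homeomorphUnitSphereProd.lintegral_comp_emb
          (Homeomorph.measurableEmbedding _) (f ∘ Subtype.val ∘ Prod.snd))
    _ = (volume : Measure E).toSphere univ *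
          ∫⁻ x : Ioi (0 : ℝ), f x ∂.volumeIoiPow (finrank ℝ E - 1) := by
        rw [lintegral_prod _ (by fun_prop)]
        simp [mul_comm]
    _ = _ := by
        congr 1
        rw [Measure.volumeIoiPow, lintegral_withDensity_eq_lintegral_mul _ (by fun_prop)
          (by fun_prop)]
        exact lintegral_subtype_comap measurableSet_Ioi
          fun r : ℝ => ENNReal.ofReal (r ^ (finrank ℝ E - 1)) * f r

theorem stdGaussian_eq_withDensity :
    stdGaussian E = volume.withDensity fun x : E =>
      ENNReal.ofReal ((((Real.pi / (1 / 2)) ^ (finrank ℝ E / 2 : ℝ))⁻¹) *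
        Real.exp (-(1 / 2) * ‖x‖ ^ 2)) := by
  set C : ℝ := (((Real.pi / (1 / 2)) ^ (finrank ℝ E / 2 : ℝ))⁻¹) with hC
  have hC0 : 0 < C := by positivity
  have hint : Integrable (fun x : E => C * Real.exp (-(1 / 2) * ‖x‖ ^ 2)) := by
    refine Integrable.const_mul ?_ C
    -- A non-integrable function has integral `0` by convention, but the Gaussian formula gives a
    -- positive value.
    refine not_not.1 fun h => ?_
    have h1 := GaussianFourier.integral_rexp_neg_mul_sq_norm (V := E) (b := 1 / 2) (by norm_num)
    rw [integral_undef h] at h1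
    have : 0 < (Real.pi / (1 / 2)) ^ (finrank ℝ E / 2 : ℝ) := by positivity
    linarith
  have : IsFiniteMeasure (volume.withDensity fun x : E =>
      ENNReal.ofReal (C * Real.exp (-(1 / 2) * ‖x‖ ^ 2))) := by
    refine isFiniteMeasure_withDensity_ofReal hint.2
  apply Measure.ext_of_charFun
  ext t
  rw [charFun_stdGaussian, charFun_apply, integral_withDensity_eq_integral_toReal_smul
    (by fun_prop) (by simp)]
  have h1 := GaussianFourier.integral_cexp_neg_mul_sq_norm_add (V := E) (b := 1 / 2) (by norm_num)
    Complex.I t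
  have h2 : ∀ x : E, (ENNReal.ofReal (C * Real.exp (-(1 / 2) * ‖x‖ ^ 2))).toReal •
      Complex.exp (⟪x, t⟫ * Complex.I) =
      (C : ℂ) * Complex.exp (-(1 / 2) * ‖x‖ ^ 2 + Complex.I * ⟪t, x⟫) := by
    intro x
    rw [ENNReal.toReal_ofReal (by positivity), Complex.exp_add, real_inner_comm, Complex.real_smul]
    push_cast
    ring_nf
  simp_rw [h2]
  rw [integral_const_mul, h1, ← mul_assoc]
  have h3 : (C : ℂ) * ((Real.pi : ℂ) / (1 / 2)) ^ ((finrank ℝ E : ℂ) / 2) = 1 := by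
    have h4 : ((Real.pi : ℂ) / (1 / 2)) ^ ((finrank ℝ E : ℂ) / 2) =
        (((Real.pi / (1 / 2)) ^ (finrank ℝ E / 2 : ℝ) : ℝ) : ℂ) := by
      rw [Complex.ofReal_cpow (by positivity)]
      push_cast
      rfl
    rw [h4, hC, ← Complex.ofReal_mul, inv_mul_cancel₀ (by positivity), Complex.ofReal_one]
  rw [h3, one_mul, Complex.I_sq]
  congr 1
  ring

end

/-- The substitution `t = s² / (s² + 1)` in an integral against a beta distribution. -/
theorem lintegral_betaMeasure_eq {d : ℕ} (hd : 0 < d) {g : ℝ → ℝ≥0∞} (hg : Measurable g) :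
    ∫⁻ t, g t ∂(betaMeasure (d / 2) (1 / 2)) =
      ENNReal.ofReal (2 / beta (d / 2) (1 / 2)) * ∫⁻ s in Ioi (0 : ℝ),
        ENNReal.ofReal (s ^ (d - 1) * (Real.sqrt (s ^ 2 + 1))⁻¹ ^ (d + 1)) *
          g (s ^ 2 / (s ^ 2 + 1)) := by
  have hB : 0 < beta (d / 2 : ℝ) (1 / 2) := beta_pos (by positivity) (by norm_num)
  have himg : (fun s : ℝ => s ^ 2 / (s ^ 2 + 1)) '' Ioi 0 = Ioo 0 1 := by
    ext t
    constructor
    · rintro ⟨s, hs, rfl⟩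
      have hs' : (0 : ℝ) < s := hs
      refine ⟨by positivity, ?_⟩
      show s ^ 2 / (s ^ 2 + 1) < 1
      rw [div_lt_one (by positivity)]
      linarith
    · rintro ⟨h0, h1⟩
      have h2 : 0 < 1 - t := by linarith
      refine ⟨Real.sqrt (t / (1 - t)), Real.sqrt_pos.2 (by positivity), ?_⟩
      show Real.sqrt (t / (1 - t)) ^ 2 / (Real.sqrt (t / (1 - t)) ^ 2 + 1) = t
      rw [Real.sq_sqrt (by positivity)]
      field_simp
      ring
  have hder : ∀ s ∈ Ioi (0 : ℝ), HasDerivWithinAt (fun s : ℝ => s ^ 2 / (s ^ 2 + 1))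
      (2 * s / (s ^ 2 + 1) ^ 2) (Ioi 0) s := by
    intro s _
    have h1 : HasDerivAt (fun s : ℝ => s ^ 2) (2 * s) s := by simpa using hasDerivAt_pow 2 s
    have h2 := h1.div (h1.add_const 1) (by positivity)
    refine (h2.congr_deriv ?_).hasDerivWithinAt
    congr 1
    ring
  have hinj : InjOn (fun s : ℝ => s ^ 2 / (s ^ 2 + 1)) (Ioi 0) := by
    intro x hx y hy hxy
    have hx' : (0 : ℝ) < x := hx
    have hy' : (0 : ℝ) < y := hy
    have hxy' : x ^ 2 / (x ^ 2 + 1) = y ^ 2 / (y ^ 2 + 1) := hxy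
    rw [div_eq_div_iff (by positivity) (by positivity)] at hxy'
    exact (sq_eq_sq₀ hx'.le hy'.le).1 (by linarith)
  have hm : Measurable (betaPDF (d / 2) (1 / 2)) := (measurable_betaPDFReal _ _).ennreal_ofReal
  rw [betaMeasure, lintegral_withDensity_eq_lintegral_mul _ hm hg]
  have h1 : ∫⁻ t, (betaPDF (d / 2) (1 / 2) * g) t = ∫⁻ t in Ioo 0 1,
      ENNReal.ofReal (1 / beta (d / 2) (1 / 2) * t ^ ((d : ℝ) / 2 - 1) * (1 - t) ^ ((1 : ℝ) / 2 - 1))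
        * g t := by
    rw [← lintegral_indicator measurableSet_Ioo]
    refine lintegral_congr fun t => ?_
    by_cases ht : t ∈ Ioo (0 : ℝ) 1
    · rw [indicator_of_mem ht, Pi.mul_apply, betaPDF_of_pos_lt_one ht.1 ht.2]
    · rw [indicator_of_notMem ht, Pi.mul_apply, betaPDF_eq,
        if_neg (fun h : 0 < t ∧ t < 1 => ht h)]
      simp
  rw [h1, ← himg, lintegral_image_eq_lintegral_abs_deriv_mul measurableSet_Ioi hder hinj,
    ← lintegral_const_mul' _ _ ENNReal.ofReal_ne_top]
  refine setLIntegral_congr_fun measurableSet_Ioi fun s hs => ?_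
  have hs' : (0 : ℝ) < s := hs
  rw [← mul_assoc, ← mul_assoc, ← ENNReal.ofReal_mul (by positivity),
    ← ENNReal.ofReal_mul (by positivity)]
  congr 2
  set c : ℝ := s ^ 2 + 1 with hc
  have hc0 : 0 < c := by positivity
  have e1 : 1 - s ^ 2 / c = c⁻¹ := by
    field_simp
    rw [hc]; ring
  have e2 : (s ^ 2 / c) ^ ((d : ℝ) / 2 - 1) = s ^ ((d : ℝ) - 2) * c ^ (1 - (d : ℝ) / 2) := by
    rw [Real.div_rpow (by positivity) hc0.le, ← Real.rpow_natCast s 2, ← Real.rpow_mul hs'.le,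
      div_eq_mul_inv, ← Real.rpow_neg hc0.le]
    congr 2 <;> push_cast <;> ring
  have e3 : (c⁻¹) ^ ((1 : ℝ) / 2 - 1) = c ^ ((1 : ℝ) / 2) := by
    rw [← Real.rpow_neg_one c, ← Real.rpow_mul hc0.le]
    norm_num
  have e4 : (Real.sqrt c)⁻¹ ^ (d + 1) = c ^ (-((d : ℝ) + 1) / 2) := by
    rw [Real.sqrt_eq_rpow, ← Real.rpow_neg hc0.le, ← Real.rpow_natCast, ← Real.rpow_mul hc0.le]
    congr 1; push_cast; ring
  have e5 : s ^ (d - 1) = s * s ^ ((d : ℝ) - 2) := by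
    nth_rewrite 2 [← Real.rpow_one s]
    rw [← Real.rpow_natCast, Nat.cast_sub hd, ← Real.rpow_add hs']
    congr 1; push_cast; ring
  have e6 : c ^ (-((d : ℝ) + 1) / 2) = c ^ (1 - (d : ℝ) / 2) * c ^ ((1 : ℝ) / 2) * (c ^ 2)⁻¹ := by
    rw [← Real.rpow_natCast c 2, ← Real.rpow_neg hc0.le, ← Real.rpow_add hc0, ← Real.rpow_add hc0]
    congr 1; push_cast; ring
  rw [abs_of_pos (by positivity), e1, e2, e3, e4, e5, e6]
  field_simp

section

variable {E : Type*} [NormedAddCommGroup E] [InnerProductSpace ℝ E] [FiniteDimensional ℝ E]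
  [MeasurableSpace E] [BorelSpace E]

/-- The substitution `r = |z| s` frees the argument of `g` from `z`. -/
theorem lintegral_gaussian_ratio_inner (d : ℕ) (hd : 0 < d) {g : ℝ → ℝ≥0∞} {z : ℝ}
    (hz : z ≠ 0) :
    ∫⁻ r in Ioi 0, ENNReal.ofReal (r ^ (d - 1)) *
        (ENNReal.ofReal (Real.exp (-(1 / 2) * r ^ 2)) * g (r ^ 2 / (r ^ 2 + z ^ 2))) =
      ∫⁻ s in Ioi 0, ENNReal.ofReal (s ^ (d - 1)) * g (s ^ 2 / (s ^ 2 + 1)) *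
        ENNReal.ofReal (|z| ^ d * Real.exp (-(1 / 2) * (z ^ 2 * s ^ 2))) := by
  have hz' : 0 < |z| := abs_pos.2 hz
  rw [lintegral_scale_Ioi hz', ← lintegral_const_mul' _ _ ENNReal.ofReal_ne_top]
  refine setLIntegral_congr_fun measurableSet_Ioi fun s hs => ?_
  have hs' : (0 : ℝ) < s := hs
  have e1 : (|z| * s) ^ 2 / ((|z| * s) ^ 2 + z ^ 2) = s ^ 2 / (s ^ 2 + 1) := by
    rw [mul_pow, sq_abs]
    field_simp
  have e2 : |z| * (|z| * s) ^ (d - 1) = |z| ^ d * s ^ (d - 1) := by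
    rw [mul_pow, ← mul_assoc, ← pow_succ', Nat.sub_add_cancel hd]
  rw [e1, mul_right_comm (ENNReal.ofReal (s ^ (d - 1))), ← mul_assoc, ← mul_assoc,
    ← ENNReal.ofReal_mul (by positivity), ← ENNReal.ofReal_mul (by positivity), e2,
    ← ENNReal.ofReal_mul (by positivity)]
  congr 2
  rw [mul_pow, sq_abs]
  ring

/-- Rescaling `z` by `(s² + 1)^(-1/2)`: `d` factors come from `|z|^d` and one from the Jacobian. -/
theorem lintegral_gaussian_moment_scale (d : ℕ) (s : ℝ) :
    ∫⁻ z : ℝ, ENNReal.ofReal (|z| ^ d * Real.exp (-(1 / 2) * (z ^ 2 * (s ^ 2 + 1)))) =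
      ENNReal.ofReal ((Real.sqrt (s ^ 2 + 1))⁻¹ ^ (d + 1)) *
        ∫⁻ z : ℝ, ENNReal.ofReal (|z| ^ d * Real.exp (-(1 / 2) * z ^ 2)) := by
  have hc : 0 < Real.sqrt (s ^ 2 + 1) := Real.sqrt_pos.2 (by positivity)
  rw [lintegral_scale (inv_pos.2 hc), pow_succ' _ d, ENNReal.ofReal_mul (by positivity), mul_assoc]
  congr 1
  rw [← lintegral_const_mul' _ _ ENNReal.ofReal_ne_top]
  refine lintegral_congr fun z => ?_
  rw [← ENNReal.ofReal_mul (by positivity), abs_mul, abs_of_pos (inv_pos.2 hc), mul_pow, mul_pow,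
    inv_pow _ 2, Real.sq_sqrt (by positivity)]
  congr 1
  have : (s ^ 2 + 1)⁻¹ * z ^ 2 * (s ^ 2 + 1) = z ^ 2 := by field_simp
  rw [this]
  ring

/-- Up to a constant, the law of `‖Z‖² / (‖Z‖² + z²)` for independent standard Gaussian `Z`, `z`. -/
theorem exists_lintegral_gaussian_ratio (hE : 0 < finrank ℝ E) :
    ∃ K : ℝ≥0∞, ∀ g : ℝ → ℝ≥0∞, Measurable g →
      ∫⁻ z, ∫⁻ x, g (‖x‖ ^ 2 / (‖x‖ ^ 2 + z ^ 2)) ∂(stdGaussian E) ∂(gaussianReal 0 1) =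
        K * ∫⁻ s in Ioi (0 : ℝ), ENNReal.ofReal (s ^ (finrank ℝ E - 1) *
          (Real.sqrt (s ^ 2 + 1))⁻¹ ^ (finrank ℝ E + 1)) * g (s ^ 2 / (s ^ 2 + 1)) := by
  have : Nontrivial E := finrank_pos_iff.1 hE
  set d := finrank ℝ E with hd
  set C : ℝ := ((Real.pi / (1 / 2)) ^ (d / 2 : ℝ))⁻¹ with hC
  set C' : ℝ := (Real.sqrt (2 * Real.pi * (1 : NNReal)))⁻¹ with hC'
  set M : ℝ≥0∞ := ∫⁻ z : ℝ, ENNReal.ofReal (|z| ^ d * Real.exp (-(1 / 2) * z ^ 2)) with hM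
  have hC0 : 0 ≤ C := by positivity
  have hC0' : 0 ≤ C' := by positivity
  set S := (volume : Measure E).toSphere univ
  refine ⟨ENNReal.ofReal C' * (ENNReal.ofReal C * S) * M, fun g hg => ?_⟩
  have h1 : ∀ z : ℝ, z ≠ 0 → ∫⁻ x, g (‖x‖ ^ 2 / (‖x‖ ^ 2 + z ^ 2)) ∂(stdGaussian E) =
      ENNReal.ofReal C * S * ∫⁻ s in Ioi 0, ENNReal.ofReal (s ^ (d - 1)) * g (s ^ 2 / (s ^ 2 + 1)) *
        ENNReal.ofReal (|z| ^ d * Real.exp (-(1 / 2) * (z ^ 2 * s ^ 2))) := by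
    intro z hz
    rw [stdGaussian_eq_withDensity, lintegral_withDensity_eq_lintegral_mul _ (by fun_prop)
      (by fun_prop), ← lintegral_gaussian_ratio_inner d hE hz, mul_assoc,
      ← lintegral_fun_norm (E := E) (f := fun r => ENNReal.ofReal (Real.exp (-(1 / 2) * r ^ 2)) *
        g (r ^ 2 / (r ^ 2 + z ^ 2))) (by fun_prop), ← lintegral_const_mul' _ _ ENNReal.ofReal_ne_top]
    refine lintegral_congr fun x => ?_
    rw [Pi.mul_apply, ENNReal.ofReal_mul hC0, mul_assoc]
  have hmeas : Measurable fun z : ℝ => ∫⁻ x : E, g (‖x‖ ^ 2 / (‖x‖ ^ 2 + z ^ 2)) ∂stdGaussian E :=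
    Measurable.lintegral_prod_right'
      (f := fun q : ℝ × E => g (‖q.2‖ ^ 2 / (‖q.2‖ ^ 2 + q.1 ^ 2))) (by fun_prop)
  rw [gaussianReal_of_var_ne_zero 0 one_ne_zero, lintegral_withDensity_eq_lintegral_mul₀
    (by fun_prop) hmeas.aemeasurable]
  calc ∫⁻ z, (gaussianPDF 0 1 * fun z => ∫⁻ x, g (‖x‖ ^ 2 / (‖x‖ ^ 2 + z ^ 2)) ∂(stdGaussian E)) z
      = ∫⁻ z, ENNReal.ofReal C' * (ENNReal.ofReal C * S) * ∫⁻ s in Ioi 0,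
          ENNReal.ofReal (s ^ (d - 1)) * g (s ^ 2 / (s ^ 2 + 1)) *
          ENNReal.ofReal (|z| ^ d * Real.exp (-(1 / 2) * (z ^ 2 * (s ^ 2 + 1)))) := by
        refine lintegral_congr_ae ?_
        have h0 : ∀ᵐ z : ℝ, z ≠ 0 := by simp [ae_iff]
        filter_upwards [h0] with z hz
        rw [Pi.mul_apply, h1 z hz, gaussianPDF, gaussianPDFReal, ENNReal.ofReal_mul hC0',
          mul_assoc, mul_left_comm (ENNReal.ofReal (Real.exp _)), ← mul_assoc,
          ← lintegral_const_mul' _ _ ENNReal.ofReal_ne_top]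
        congr 1
        refine lintegral_congr fun s => ?_
        rw [mul_left_comm, ← ENNReal.ofReal_mul (by positivity), mul_left_comm, ← Real.exp_add]
        congr 4
        push_cast
        ring
    -- By Tonelli, the inner integral over `z` becomes a Gaussian absolute moment, a constant times
    -- a power of `s² + 1`.
    _ = ENNReal.ofReal C' * (ENNReal.ofReal C * S) * ∫⁻ s in Ioi 0, ∫⁻ z : ℝ,
          ENNReal.ofReal (s ^ (d - 1)) * g (s ^ 2 / (s ^ 2 + 1)) *
          ENNReal.ofReal (|z| ^ d * Real.exp (-(1 / 2) * (z ^ 2 * (s ^ 2 + 1)))) := by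
        rw [lintegral_const_mul _ (by fun_prop), lintegral_lintegral_swap (by fun_prop)]
    _ = _ := by
        rw [mul_assoc (ENNReal.ofReal C' * (ENNReal.ofReal C * S))]
        congr 1
        rw [← lintegral_const_mul M (by fun_prop)]
        refine setLIntegral_congr_fun measurableSet_Ioi fun s hs => ?_
        have hs' : (0 : ℝ) < s := hs
        rw [lintegral_const_mul _ (by fun_prop), lintegral_gaussian_moment_scale,
          ENNReal.ofReal_mul (by positivity)]
        ring

/-- Both laws are the same integral over `s` up to a constant. The constants need no evaluation:
both measures have mass 1, so `g = 1` shows that they agree. -/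
theorem gaussian_ratio_law (hE : 0 < finrank ℝ E) :
    ((gaussianReal 0 1).prod (stdGaussian E)).map
        (fun q : ℝ × E => ‖q.2‖ ^ 2 / (‖q.2‖ ^ 2 + q.1 ^ 2)) =
      betaMeasure (finrank ℝ E / 2) (1 / 2) := by
  obtain ⟨K, hK⟩ := exists_lintegral_gaussian_ratio (E := E) hE
  have := isProbabilityMeasureBeta (α := (finrank ℝ E / 2 : ℝ)) (β := 1 / 2) (by positivity)
    (by norm_num)
  have hB := fun g => lintegral_betaMeasure_eq hE (g := g)
  have hK1 := hK (fun _ => 1) measurable_const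
  have hB1 := hB (fun _ => 1) measurable_const
  simp only [lintegral_const, measure_univ, mul_one] at hK1 hB1
  have hJ : K = ENNReal.ofReal (2 / beta (finrank ℝ E / 2) (1 / 2)) := by
    rw [← mul_one K, hB1, mul_left_comm, ← hK1, mul_one]
  ext A hA
  have hg : Measurable (A.indicator (1 : ℝ → ℝ≥0∞)) := measurable_one.indicator hA
  rw [← lintegral_indicator_one hA, ← lintegral_indicator_one hA, hB _ hg,
    lintegral_map hg (by fun_prop), lintegral_prod _ (by fun_prop), hK _ hg, hJ]

end

/-! ### Bounds for the beta distribution function and its quantiles. -/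

theorem betaMeasure_Iic_zero (a b : ℝ) : betaMeasure a b (Iic 0) = 0 := by
  rw [betaMeasure, withDensity_apply _ measurableSet_Iic]
  exact setLIntegral_eq_zero measurableSet_Iic fun x hx => betaPDF_eq_zero_of_nonpos hx

theorem betaMeasure_Ioi_one (a b : ℝ) : betaMeasure a b (Ioi 1) = 0 := by
  rw [betaMeasure, withDensity_apply _ measurableSet_Ioi]
  exact setLIntegral_eq_zero measurableSet_Ioi fun x hx => betaPDF_eq_zero_of_one_le (le_of_lt hx)

/-- Below the infimum the distribution function is at most `q`; approach it from the left and use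
that there are no atoms. -/
theorem betaMeasure_Iic_betaInvCDF_le {a b q : ℝ} (ha : 0 < a) (hb : 0 < b) :
    betaMeasure a b (Iic (betaInvCDF a b q)) ≤ ENNReal.ofReal q := by
  have := isProbabilityMeasureBeta ha hb
  have hna : NullSingletonClass (betaMeasure a b) := by unfold betaMeasure; infer_instance
  set G := betaInvCDF a b q with hG
  have hlt : ∀ x < G, betaMeasure a b (Iic x) ≤ ENNReal.ofReal q := by
    intro x hx
    rcases lt_or_ge x 0 with h0 | h0
    · exact (measure_mono (Iic_subset_Iic.2 h0.le)).trans
        ((betaMeasure_Iic_zero a b).le.trans zero_le)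
    · rw [← ofReal_cdf]
      refine ENNReal.ofReal_le_ofReal ?_
      by_contra! h
      have : G ≤ x := csInf_le ⟨0, fun y hy => hy.1⟩ ⟨h0, h.le⟩
      linarith
  obtain ⟨u, hu, hult, hulim⟩ := exists_seq_strictMono_tendsto G
  have hU : ⋃ n, Iic (u n) = Iio G := by
    ext x
    simp only [mem_iUnion, mem_Iic, mem_Iio]
    constructor
    · rintro ⟨n, hn⟩
      exact hn.trans_lt (hult n)
    · intro hx
      obtain ⟨n, hn⟩ := (hulim.eventually (lt_mem_nhds hx)).exists
      exact ⟨n, hn.le⟩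
  rw [← Iio_ae_eq_Iic.measure_eq, ← hU,
    (monotone_nat_of_le_succ fun n => Iic_subset_Iic.2 (hu.monotone n.le_succ)).measure_iUnion]
  exact iSup_le fun n => hlt _ (hult n)

/-- The bound `q ≤ 1` puts the point `1` in the defining set; the infimum of an empty set would be
the default `0`. -/
theorem le_betaInvCDF {a b q x : ℝ} (ha : 0 < a) (hb : 0 < b) (hq : q ≤ 1)
    (hx : betaMeasure a b (Iic x) < ENNReal.ofReal q) : x ≤ betaInvCDF a b q := by
  have := isProbabilityMeasureBeta ha hb
  refine le_csInf ⟨1, zero_le_one, ?_⟩ fun y hy => ?_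
  · have h1 : betaMeasure a b (Iic 1) = 1 := by
      rw [← compl_Ioi, prob_compl_eq_one_sub measurableSet_Ioi, betaMeasure_Ioi_one, tsub_zero]
    rw [cdf_eq_real, measureReal_def, h1]
    simpa using hq
  · by_contra! h
    have h1 : ENNReal.ofReal q ≤ betaMeasure a b (Iic x) := by
      rw [← ofReal_cdf]
      exact ENNReal.ofReal_le_ofReal (hy.2.trans (monotone_cdf _ h.le))
    exact absurd hx h1.not_gt

theorem lintegral_rpow_Ioo {a x : ℝ} (ha : 0 < a) (hx : 0 ≤ x) :
    ∫⁻ t in Ioo 0 x, ENNReal.ofReal (t ^ (a - 1)) = ENNReal.ofReal (x ^ a / a) := by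
  have hi : IntervalIntegrable (fun t : ℝ => t ^ (a - 1)) volume 0 x :=
    intervalIntegral.intervalIntegrable_rpow' (by linarith)
  rw [Measure.restrict_congr_set Ioo_ae_eq_Ioc, ← ofReal_integral_eq_lintegral_ofReal hi.1,
    ← intervalIntegral.integral_of_le hx, integral_rpow (Or.inl (by linarith))]
  · rw [sub_add_cancel, Real.zero_rpow ha.ne', sub_zero]
  · filter_upwards [ae_restrict_mem measurableSet_Ioc] with t ht
    exact Real.rpow_nonneg ht.1.le _

/-- For `b ≤ 1` the factor `(1 - t)^(b - 1)` is at least 1, so the beta integral is at least `∫ t^(a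
- 1) = 1/a`. -/
theorem inv_beta_le {a b : ℝ} (ha : 0 < a) (hb : 0 < b) (hb1 : b ≤ 1) : 1 / beta a b ≤ a := by
  have hB := beta_pos ha hb
  have h1 := lintegral_betaPDF_eq_one ha hb
  rw [lintegral_betaPDF] at h1
  have h2 : ENNReal.ofReal (1 / beta a b) * ENNReal.ofReal (1 ^ a / a) ≤ 1 := by
    rw [← lintegral_rpow_Ioo ha zero_le_one, ← h1, ← lintegral_const_mul' _ _ ENNReal.ofReal_ne_top]
    refine setLIntegral_mono' measurableSet_Ioo fun t ht => ?_
    have h3 : 0 < 1 - t := by linarith [ht.2]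
    rw [← ENNReal.ofReal_mul (by positivity)]
    refine ENNReal.ofReal_le_ofReal (le_mul_of_one_le_right ?_ ?_)
    · have := Real.rpow_nonneg ht.1.le (a - 1)
      positivity
    · exact Real.one_le_rpow_of_pos_of_le_one_of_nonpos h3 (by linarith [ht.1]) (by linarith)
  rw [← ENNReal.ofReal_mul (by positivity), ENNReal.ofReal_le_one, Real.one_rpow, mul_one_div,
    div_le_one ha] at h2
  exact h2

/-- On `(0, x)` the factor `(1 - t)^(b - 1)` is largest at `x`. The bound `a` on the normalising
constant cancels the `1/a` from integrating `t^(a - 1)`. -/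
theorem betaMeasure_Iic_le {a b x : ℝ} (ha : 0 < a) (hb : 0 < b) (hb1 : b ≤ 1) (hx : 0 < x)
    (hx1 : x < 1) :
    betaMeasure a b (Iic x) ≤ ENNReal.ofReal (x ^ a * (1 - x) ^ (b - 1)) := by
  have hB := beta_pos ha hb
  have hx2 : 0 < 1 - x := by linarith
  have h1 : betaMeasure a b (Iic x) = betaMeasure a b (Ioc 0 x) := by
    rw [← Iic_union_Ioc_eq_Iic hx.le]
    refine le_antisymm ((measure_union_le _ _).trans ?_) (measure_mono subset_union_right)
    rw [betaMeasure_Iic_zero, zero_add]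
  have h2 : betaMeasure a b (Ioc 0 x) = ∫⁻ t in Ioo 0 x, betaPDF a b t := by
    rw [betaMeasure, withDensity_apply _ measurableSet_Ioc, Measure.restrict_congr_set Ioo_ae_eq_Ioc]
  rw [h1, h2]
  calc ∫⁻ t in Ioo 0 x, betaPDF a b t
      ≤ ∫⁻ t in Ioo 0 x, ENNReal.ofReal (a * (1 - x) ^ (b - 1)) * ENNReal.ofReal (t ^ (a - 1)) := by
        refine setLIntegral_mono' measurableSet_Ioo fun t ht => ?_
        rw [betaPDF_of_pos_lt_one ht.1 (ht.2.trans hx1), ← ENNReal.ofReal_mul (by positivity)]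
        refine ENNReal.ofReal_le_ofReal ?_
        have h3 : (1 - t) ^ (b - 1) ≤ (1 - x) ^ (b - 1) :=
          Real.rpow_le_rpow_of_nonpos hx2 (by linarith [ht.2]) (by linarith)
        have h4 := Real.rpow_nonneg ht.1.le (a - 1)
        calc 1 / beta a b * t ^ (a - 1) * (1 - t) ^ (b - 1)
            ≤ a * t ^ (a - 1) * (1 - x) ^ (b - 1) := by
              have h5 : 0 ≤ (1 - t) ^ (b - 1) := Real.rpow_nonneg (by linarith [ht.2]) _
              have h6 := inv_beta_le ha hb hb1
              gcongr
          _ = _ := by ring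
    _ = ENNReal.ofReal (x ^ a * (1 - x) ^ (b - 1)) := by
        rw [lintegral_const_mul' _ _ ENNReal.ofReal_ne_top, lintegral_rpow_Ioo ha hx.le,
          ← ENNReal.ofReal_mul (by positivity)]
        congr 1
        field_simp

/-! ### Nested column spans, residuals and the model order. -/

section

variable {n p : ℕ} {X : Matrix (Fin n) (Fin p) ℝ}

theorem linearIndependent_column (hX : X.rank = p) : LinearIndependent ℝ (column X) := by
  have h1 : LinearIndependent ℝ X.col := by
    rw [linearIndependent_iff_card_eq_finrank_span, Fintype.card_fin, Set.finrank,
      ← Matrix.rank_eq_finrank_span_cols, hX]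
  exact h1.map' (WithLp.linearEquiv 2 ℝ (Fin n → ℝ)).symm.toLinearMap (LinearEquiv.ker _)

theorem finrank_colSpan (hX : X.rank = p) {k : ℕ} (hk : k ≤ p) : finrank ℝ (colSpan X k) = k := by
  have h1 := (linearIndependent_column hX).comp (fun i : Fin k => Fin.castLE hk i)
    (Fin.castLE_injective hk)
  have h2 := finrank_span_eq_card h1
  rw [Fintype.card_fin] at h2
  have h3 : column X '' {j : Fin p | (j : ℕ) < k} =
      range (column X ∘ fun i : Fin k => Fin.castLE hk i) := by
    ext v
    constructor
    · rintro ⟨j, hj, rfl⟩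
      exact ⟨⟨j, hj⟩, rfl⟩
    · rintro ⟨i, rfl⟩
      exact ⟨Fin.castLE hk i, i.2, rfl⟩
  rw [colSpan, h3, h2]

theorem finrank_colSpan_orthogonal (hX : X.rank = p) {k : ℕ} (hk : k ≤ p) :
    finrank ℝ ((colSpan X k)ᗮ : Submodule ℝ (EuclideanSpace ℝ (Fin n))) = n - k := by
  have h1 := (colSpan X k).finrank_add_finrank_orthogonal
  rw [finrank_colSpan hX hk, finrank_euclideanSpace, Fintype.card_fin] at h1
  omega

theorem colSpan_mono {k l : ℕ} (hkl : k ≤ l) : colSpan X k ≤ colSpan X l :=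
  Submodule.span_mono (image_mono fun _ hj => lt_of_lt_of_le hj hkl)

theorem column_mem_colSpan {j : Fin p} {k : ℕ} (hj : (j : ℕ) < k) : column X j ∈ colSpan X k :=
  Submodule.subset_span ⟨j, hj, rfl⟩

theorem colSpan_succ (j : Fin p) :
    colSpan X (j + 1) = colSpan X j ⊔ Submodule.span ℝ {column X j} := by
  rw [colSpan, colSpan, ← Submodule.span_union, ← image_singleton, ← image_union]
  congr 2
  ext i
  simp only [mem_ofPred_eq, mem_union, mem_singleton_iff, Fin.ext_iff]
  omega

theorem column_notMem_colSpan (hX : X.rank = p) (j : Fin p) : column X j ∉ colSpan X j :=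
  (linearIndependent_column hX).notMem_span_image (by simp)

theorem residual_add (k : ℕ) (v v' : EuclideanSpace ℝ (Fin n)) :
    residual X k (v + v') = residual X k v + residual X k v' := by
  simp only [residual, map_add]
  abel

theorem residual_smul (k : ℕ) (c : ℝ) (v : EuclideanSpace ℝ (Fin n)) :
    residual X k (c • v) = c • residual X k v := by
  simp only [residual, map_smul, smul_sub]

theorem residual_eq_zero {k : ℕ} {v : EuclideanSpace ℝ (Fin n)} (hv : v ∈ colSpan X k) :
    residual X k v = 0 := by
  rw [residual, Submodule.starProjection_eq_self_iff.2 hv, sub_self]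

theorem residual_mem_orthogonal (k : ℕ) (v : EuclideanSpace ℝ (Fin n)) :
    residual X k v ∈ (colSpan X k)ᗮ :=
  Submodule.sub_starProjection_mem_orthogonal v

theorem norm_residual (k : ℕ) (v : EuclideanSpace ℝ (Fin n)) :
    ‖residual X k v‖ = ‖(colSpan X k)ᗮ.orthogonalProjectionOnto v‖ := by
  rw [residual, ← Submodule.starProjection_orthogonal_val, Submodule.starProjection_apply,
    Submodule.coe_norm]

theorem norm_residual_le (k : ℕ) (v : EuclideanSpace ℝ (Fin n)) : ‖residual X k v‖ ≤ ‖v‖ := by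
  rw [norm_residual]
  exact Submodule.norm_orthogonalProjectionOnto_apply_le _ v

@[fun_prop]
theorem continuous_residual (k : ℕ) : Continuous (residual X k) := by
  unfold residual
  fun_prop

/-- The normalised component of column number `j + 1` orthogonal to the preceding columns. -/
noncomputable def direction (X : Matrix (Fin n) (Fin p) ℝ) (j : Fin p) : EuclideanSpace ℝ (Fin n) :=
  ‖residual X j (column X j)‖⁻¹ • residual X j (column X j)

theorem residual_column_ne_zero (hX : X.rank = p) (j : Fin p) :
    residual X j (column X j) ≠ 0 := fun h =>
  column_notMem_colSpan hX j (Submodule.starProjection_eq_self_iff.1 (sub_eq_zero.1 h).symm)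

theorem norm_direction (hX : X.rank = p) (j : Fin p) : ‖direction X j‖ = 1 := by
  rw [direction, norm_smul, norm_inv, norm_norm,
    inv_mul_cancel₀ (norm_ne_zero_iff.2 (residual_column_ne_zero hX j))]

theorem direction_mem_orthogonal (j : Fin p) : direction X j ∈ (colSpan X j)ᗮ :=
  Submodule.smul_mem _ _ (residual_mem_orthogonal _ _)

theorem direction_mem_colSpan (j : Fin p) : direction X j ∈ colSpan X (j + 1) := by
  refine Submodule.smul_mem _ _ (Submodule.sub_mem _ (column_mem_colSpan (Nat.lt_succ_self _)) ?_)
  exact colSpan_mono (Nat.le_succ _) (Submodule.starProjection_apply_mem _ _)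

theorem norm_smul_direction (hX : X.rank = p) (j : Fin p) :
    ‖residual X j (column X j)‖ • direction X j = residual X j (column X j) := by
  rw [direction, smul_inv_smul₀ (norm_ne_zero_iff.2 (residual_column_ne_zero hX j))]

theorem inner_direction_of_mem {j : Fin p} {v : EuclideanSpace ℝ (Fin n)} (hv : v ∈ colSpan X j) :
    ⟪direction X j, v⟫ = 0 :=
  (Submodule.mem_orthogonal' _ _).1 (direction_mem_orthogonal j) v hv

theorem inner_direction_column (hX : X.rank = p) (j : Fin p) :
    ⟪direction X j, column X j⟫ = ‖residual X j (column X j)‖ := by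
  have h : column X j = (colSpan X j).starProjection (column X j) +
      ‖residual X j (column X j)‖ • direction X j := by
    rw [norm_smul_direction hX, residual]
    abel
  conv_lhs => rw [h]
  rw [inner_add_right, inner_direction_of_mem (Submodule.starProjection_apply_mem _ _),
    real_inner_smul_right, real_inner_self_eq_norm_sq, norm_direction hX]
  ring

/-- A Gram–Schmidt step: `direction X j` is the unit vector by which the span grows when one column
is added. -/
theorem residual_eq_residual_succ_add (hX : X.rank = p) (j : Fin p)
    (v : EuclideanSpace ℝ (Fin n)) :
    residual X j v = residual X (j + 1) v + ⟪direction X j, v⟫ • direction X j := by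
  have h : (colSpan X (j + 1)).starProjection v =
      (colSpan X j).starProjection v + ⟪direction X j, v⟫ • direction X j := by
    refine Submodule.eq_starProjection_of_mem_of_inner_eq_zero ?_ ?_
    · exact Submodule.add_mem _ (colSpan_mono (Nat.le_succ _) (Submodule.starProjection_apply_mem _ _))
        (Submodule.smul_mem _ _ (direction_mem_colSpan j))
    · have h0 : ∀ w ∈ colSpan X j, ⟪v - ((colSpan X j).starProjection v +
          ⟪direction X j, v⟫ • direction X j), w⟫ = 0 := by
        intro w hw
        rw [← sub_sub, inner_sub_left, real_inner_smul_left, inner_direction_of_mem hw,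
          Submodule.starProjection_inner_eq_zero _ _ hw]
        simp
      have h1 : ⟪v - ((colSpan X j).starProjection v +
          ⟪direction X j, v⟫ • direction X j), direction X j⟫ = 0 := by
        rw [inner_sub_left, inner_add_left, real_inner_smul_left, real_inner_self_eq_norm_sq,
          norm_direction hX, real_inner_comm _ ((colSpan X j).starProjection v),
          inner_direction_of_mem (Submodule.starProjection_apply_mem _ _), real_inner_comm v]
        ring
      intro w hw
      rw [colSpan_succ, Submodule.mem_sup] at hw
      obtain ⟨a, ha, b, hb, rfl⟩ := hw
      obtain ⟨c, rfl⟩ := Submodule.mem_span_singleton.1 hb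
      have h2 : column X j = (colSpan X j).starProjection (column X j) +
          ‖residual X j (column X j)‖ • direction X j := by
        rw [norm_smul_direction hX, residual]
        abel
      rw [h2, inner_add_right, real_inner_smul_right, inner_add_right, real_inner_smul_right,
        h0 a ha, h0 _ (Submodule.starProjection_apply_mem _ _), h1]
      simp
  rw [residual, residual, h]
  abel

theorem norm_sq_residual (hX : X.rank = p) (j : Fin p) (v : EuclideanSpace ℝ (Fin n)) :
    ‖residual X j v‖ ^ 2 = ‖residual X (j + 1) v‖ ^ 2 + ⟪direction X j, v⟫ ^ 2 := by
  have h : ⟪residual X (j + 1) v, ⟪direction X j, v⟫ • direction X j⟫ = 0 :=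
    (Submodule.mem_orthogonal' _ _).1 (residual_mem_orthogonal _ _) _
      (Submodule.smul_mem _ _ (direction_mem_colSpan j))
  rw [residual_eq_residual_succ_add hX, norm_add_sq_real, h, norm_smul, norm_direction hX]
  simp

/-- This is the form to which `gaussian_ratio_law` applies. -/
theorem residualRatio_succ (hX : X.rank = p) (j : Fin p) (y : EuclideanSpace ℝ (Fin n)) :
    residualRatio X y (j + 1) = ‖residual X (j + 1) y‖ ^ 2 /
      (‖residual X (j + 1) y‖ ^ 2 + ⟪direction X j, y⟫ ^ 2) := by
  rw [residualRatio, Nat.add_sub_cancel, norm_sq_residual hX]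

theorem toLp_mulVec (β : Fin p → ℝ) : WithLp.toLp 2 (X.mulVec β) = ∑ j, β j • column X j := by
  ext i
  simp [column, Matrix.mulVec, dotProduct, mul_comm]

theorem apply_eq_zero_of_modelOrder_le {β : Fin p → ℝ} {j : Fin p} (hj : modelOrder β ≤ j) :
    β j = 0 := by
  classical
  by_contra h
  have : (j : ℕ) + 1 ≤ modelOrder β := by
    unfold modelOrder
    exact Finset.le_sup (f := fun j : Fin p => (j : ℕ) + 1) (by simpa using h)
  omega

theorem exists_succ_eq_modelOrder {β : Fin p → ℝ} (hβ : β ≠ 0) :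
    ∃ j : Fin p, (j : ℕ) + 1 = modelOrder β := by
  classical
  obtain ⟨i, hi⟩ := Function.ne_iff.1 hβ
  have hne : ({j : Fin p | β j ≠ 0} : Finset (Fin p)).Nonempty := ⟨i, by simpa using hi⟩
  obtain ⟨j, _, hj⟩ := Finset.exists_mem_eq_sup _ hne fun j : Fin p => (j : ℕ) + 1
  refine ⟨j, ?_⟩
  rw [modelOrder, ← hj]

theorem mulVec_mem_colSpan (β : Fin p → ℝ) :
    WithLp.toLp 2 (X.mulVec β) ∈ colSpan X (modelOrder β) := by
  rw [toLp_mulVec]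
  refine Submodule.sum_mem _ fun j _ => ?_
  rcases lt_or_ge (j : ℕ) (modelOrder β) with h | h
  · exact Submodule.smul_mem _ _ (column_mem_colSpan h)
  · rw [apply_eq_zero_of_modelOrder_le h, zero_smul]
    exact Submodule.zero_mem _

theorem residual_observation {β : Fin p → ℝ} {k : ℕ} (hk : modelOrder β ≤ k)
    (w : EuclideanSpace ℝ (Fin n)) : residual X k (observation X β w) = residual X k w := by
  rw [observation, residual_add, residual_eq_zero (colSpan_mono hk (mulVec_mem_colSpan β)),
    zero_add]

theorem inner_direction_observation_of_le {β : Fin p → ℝ} {j : Fin p} (hj : modelOrder β ≤ j)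
    (w : EuclideanSpace ℝ (Fin n)) :
    ⟪direction X j, observation X β w⟫ = ⟪direction X j, w⟫ := by
  rw [observation, inner_add_right, inner_direction_of_mem (colSpan_mono hj (mulVec_mem_colSpan β)),
    zero_add]

/-- Columns before `j` are orthogonal to the direction, and coefficients after `j` vanish because
`j` carries the model order. -/
theorem inner_direction_observation (hX : X.rank = p) {β : Fin p → ℝ} {j : Fin p}
    (hj : (j : ℕ) + 1 = modelOrder β) (w : EuclideanSpace ℝ (Fin n)) :
    ⟪direction X j, observation X β w⟫ =
      β j * ‖residual X j (column X j)‖ + ⟪direction X j, w⟫ := by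
  rw [observation, inner_add_right, toLp_mulVec, inner_sum, Finset.sum_eq_single j]
  · rw [real_inner_smul_right, inner_direction_column hX]
  · intro i _ hij
    rw [real_inner_smul_right]
    rcases lt_or_gt_of_ne hij with h | h
    · rw [inner_direction_of_mem (column_mem_colSpan h), mul_zero]
    · rw [apply_eq_zero_of_modelOrder_le (β := β) (j := i) (by rw [← hj]; exact h), zero_mul]
  · simp

end

/-! ### Standard Gaussian vectors: independence of components and second-moment bounds. -/

section

variable {E : Type*} [NormedAddCommGroup E] [InnerProductSpace ℝ E] [FiniteDimensional ℝ E]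
  [MeasurableSpace E] [BorelSpace E]

/-- The components of a standard Gaussian vector along a unit vector and along a subspace
orthogonal to it are independent and standard Gaussian. -/
theorem stdGaussian_map_inner_orthogonalProjection (W : Submodule ℝ E) {u : E} (hu : ‖u‖ = 1)
    (huW : u ∈ Wᗮ) :
    (stdGaussian E).map (fun z => (⟪u, z⟫, W.orthogonalProjectionOnto z)) =
      (gaussianReal 0 1).prod (stdGaussian W) := by
  have hm : Measurable fun z : E => (⟪u, z⟫, W.orthogonalProjectionOnto z) := by fun_prop
  have : IsProbabilityMeasure ((stdGaussian E).map
      (fun z => (⟪u, z⟫, W.orthogonalProjectionOnto z))) :=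
    Measure.isProbabilityMeasure_map hm.aemeasurable
  refine charFun_eq_prod_iff.1 fun t => ?_
  obtain ⟨a, b⟩ := t
  have h1 : ⟪u, (b : E)⟫ = 0 := (Submodule.mem_orthogonal' _ _).1 huW b b.2
  have h2 : ‖a • u + (b : E)‖ ^ 2 = a ^ 2 + ‖b‖ ^ 2 := by
    rw [norm_add_sq_real, real_inner_smul_left, h1, norm_smul, hu]
    simp
  -- The pair's characteristic function at `(a, b)` is that of `z` at `a • u + b`; Pythagoras then
  -- factors it.
  have h3 : charFun (((stdGaussian E).map
      (fun z => (⟪u, z⟫, W.orthogonalProjectionOnto z))).map (WithLp.toLp 2)) (WithLp.toLp 2 (a, b)) =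
      charFun (stdGaussian E) (a • u + (b : E)) := by
    rw [charFun_apply, charFun_apply, Measure.map_map (by fun_prop) hm,
      integral_map (by fun_prop) (by fun_prop)]
    congr 1
    ext z
    simp only [Function.comp_apply, WithLp.prod_inner_apply]
    rw [inner_add_right, real_inner_smul_right, ← Submodule.inner_orthogonalProjectionOnto_eq_of_mem_right,
      real_inner_comm u z]
    rfl
  rw [h3, charFun_stdGaussian, charFun_gaussianReal, charFun_stdGaussian, ← Complex.exp_add,
    ← Complex.ofReal_pow, h2]
  congr 1
  push_cast
  ring

theorem lintegral_inner_sq_stdGaussian (u : E) :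
    ∫⁻ z, ENNReal.ofReal (⟪u, z⟫ ^ 2) ∂(stdGaussian E) = ENNReal.ofReal (‖u‖ ^ 2) := by
  have hL : MemLp (innerSL ℝ u) 2 (stdGaussian E) := IsGaussian.memLp_dual _ _ 2 (by simp)
  have h1 := variance_dual_stdGaussian (innerSL ℝ u)
  rw [innerSL_apply_norm] at h1
  rw [← h1, hL.ofReal_variance_eq, evariance_eq_lintegral_ofReal,
    integral_strongDual_stdGaussian]
  simp

theorem lintegral_norm_sq_stdGaussian :
    ∫⁻ z, ENNReal.ofReal (‖z‖ ^ 2) ∂(stdGaussian E) = finrank ℝ E := by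
  have h1 : ∀ z : E, ENNReal.ofReal (‖z‖ ^ 2) =
      ∑ i, ENNReal.ofReal (⟪stdOrthonormalBasis ℝ E i, z⟫ ^ 2) := by
    intro z
    rw [← ENNReal.ofReal_sum_of_nonneg fun i _ => sq_nonneg _,
      (stdOrthonormalBasis ℝ E).sum_sq_inner_right]
  simp_rw [h1]
  rw [lintegral_finsetSum _ fun i _ => by fun_prop]
  simp [lintegral_inner_sq_stdGaussian]

theorem stdGaussian_le_inner_sq_le {u : E} (hu : ‖u‖ = 1) {c : ℝ} (hc : 0 < c) :
    stdGaussian E {z | c ≤ ⟪u, z⟫ ^ 2} ≤ ENNReal.ofReal (1 / c) := by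
  have h := meas_ge_le_lintegral_div (μ := stdGaussian E)
    (f := fun z => ENNReal.ofReal (⟪u, z⟫ ^ 2)) (ε := ENNReal.ofReal c) (by fun_prop)
    (by simpa using hc) ENNReal.ofReal_ne_top
  rw [lintegral_inner_sq_stdGaussian, hu, one_pow, ← ENNReal.ofReal_div_of_pos hc] at h
  exact (measure_mono fun z hz => ENNReal.ofReal_le_ofReal hz).trans h

/-- Markov's inequality for `E‖z‖² = dim E`; no finer concentration is required. -/
theorem stdGaussian_le_norm_sq_le (hE : 0 < finrank ℝ E) {L : ℝ} (hL : 0 < L) :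
    stdGaussian E {z | L * finrank ℝ E ≤ ‖z‖ ^ 2} ≤ ENNReal.ofReal (1 / L) := by
  have hc : 0 < L * finrank ℝ E := by positivity
  have h := meas_ge_le_lintegral_div (μ := stdGaussian E)
    (f := fun z => ENNReal.ofReal (‖z‖ ^ 2)) (ε := ENNReal.ofReal (L * finrank ℝ E)) (by fun_prop)
    (by simpa using hc) ENNReal.ofReal_ne_top
  rw [lintegral_norm_sq_stdGaussian, ← ENNReal.ofReal_natCast, ← ENNReal.ofReal_div_of_pos hc] at h
  refine (measure_mono fun z hz => ENNReal.ofReal_le_ofReal hz).trans (h.trans_eq ?_)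
  congr 1
  field_simp

end

/-! ### The noise law and the residual ratio at and beyond the model order. -/

section

variable {n : ℕ}

theorem noiseLaw_eq_map {σ : ℝ} : noiseLaw n σ =
    (stdGaussian (EuclideanSpace ℝ (Fin n))).map (fun z => σ • z) := by
  have hS : (((σ ^ 2) • (1 : Matrix (Fin n) (Fin n) ℝ))).PosSemidef :=
    Matrix.PosSemidef.one.smul (sq_nonneg σ)
  have := Measure.isProbabilityMeasure_map (μ := stdGaussian (EuclideanSpace ℝ (Fin n)))
    (f := fun z => σ • z) (by fun_prop)
  unfold noiseLaw
  apply Measure.ext_of_charFun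
  ext t
  rw [charFun_multivariateGaussian hS, charFun_map_smul, charFun_stdGaussian,
    norm_smul, Matrix.smul_mulVec, Matrix.one_mulVec, dotProduct_smul]
  have h : (t : Fin n → ℝ) ⬝ᵥ (t : Fin n → ℝ) = ‖t‖ ^ 2 := by
    rw [EuclideanSpace.real_norm_sq_eq]
    simp [dotProduct, sq]
  rw [h, ← Complex.ofReal_pow, Real.norm_eq_abs, mul_pow, sq_abs]
  simp
  ring_nf

end

section

variable {n p : ℕ} {X : Matrix (Fin n) (Fin p) ℝ} {β : Fin p → ℝ}

@[fun_prop]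
theorem measurable_residualRatio_observation (k : ℕ) :
    Measurable fun w => residualRatio X (observation X β w) k := by
  have h : Continuous (observation X β) := by unfold observation; fun_prop
  have h1 := ((continuous_residual (X := X) k).comp h).norm.measurable
  have h2 := ((continuous_residual (X := X) (k - 1)).comp h).norm.measurable
  exact (h1.pow_const 2).div (h2.pow_const 2)

/-- Past the model order, the residual ratio has a beta distribution. -/
theorem noiseLaw_map_residualRatio (hX : X.rank = p) (hpn : p < n) {σ : ℝ} (hσ : 0 < σ) {j : Fin p}
    (hj : modelOrder β ≤ j) :
    (noiseLaw n σ).map (fun w => residualRatio X (observation X β w) (j + 1)) =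
      betaMeasure (((n : ℝ) - ((j + 1 : ℕ) : ℝ)) / 2) (1 / 2) := by
  have hjp : (j : ℕ) + 1 ≤ p := j.2
  set W := (colSpan X (j + 1))ᗮ with hW
  have hfr : finrank ℝ W = n - (j + 1) := finrank_colSpan_orthogonal hX hjp
  have hfr' : ((finrank ℝ W : ℕ) : ℝ) = (n : ℝ) - ((j + 1 : ℕ) : ℝ) := by
    rw [hfr, Nat.cast_sub (by omega)]
  have huW : direction X j ∈ Wᗮ := by
    rw [hW, Submodule.orthogonal_orthogonal]
    exact direction_mem_colSpan j
  rw [← hfr', ← gaussian_ratio_law (by omega),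
    ← stdGaussian_map_inner_orthogonalProjection W (norm_direction hX j) huW, noiseLaw_eq_map,
    Measure.map_map (by fun_prop) (by fun_prop), Measure.map_map (by fun_prop) (by fun_prop)]
  congr 1
  ext z
  simp only [Function.comp_apply]
  -- The noise level multiplies numerator and denominator by `σ²` and cancels.
  rw [residualRatio_succ hX, residual_observation (by omega), inner_direction_observation_of_le hj,
    residual_smul, norm_smul, real_inner_smul_right, norm_residual, mul_pow, mul_pow,
    Real.norm_eq_abs, sq_abs, ← mul_add, mul_div_mul_left _ _ (by positivity)]

theorem noiseLaw_residualRatio_le_threshold (hX : X.rank = p) (hpn : p < n) {σ : ℝ} (hσ : 0 < σ)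
    {j : Fin p} (hj : modelOrder β ≤ j) (α : ℝ) :
    noiseLaw n σ {w | residualRatio X (observation X β w) (j + 1) ≤ threshold n p α (j + 1)} ≤
      ENNReal.ofReal (α / p) := by
  have hjp : ((j + 1 : ℕ) : ℝ) < n := by exact_mod_cast lt_of_le_of_lt j.2 hpn
  have h := betaMeasure_Iic_betaInvCDF_le (a := ((n : ℝ) - ((j + 1 : ℕ) : ℝ)) / 2) (b := 1 / 2)
    (q := α / p) (by linarith) (by norm_num)
  rwa [← noiseLaw_map_residualRatio hX hpn hσ hj, Measure.map_apply (by fun_prop)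
    measurableSet_Iic] at h

/-- Outside two Markov events the squared residual is at most `σ² L n` and the squared component
along the direction is at least `σ² M n / 4`; `hLx` then forces the ratio to be at most `x`. -/
theorem noiseLaw_lt_residualRatio_le (hX : X.rank = p) {σ : ℝ} (hσ : 0 < σ)
    {j : Fin p} (hj : (j : ℕ) + 1 = modelOrder β) {M L x : ℝ} (hM : 0 < M) (hL : 0 < L)
    (hx : 0 < x) (hx1 : x < 1) (hLx : (1 - x) * L ≤ x * (M / 4)) (hn : 0 < n)
    (hsnr : M * n ≤ ‖residual X j (column X j)‖ ^ 2 * |β j| ^ 2 / σ ^ 2) :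
    noiseLaw n σ {w | x < residualRatio X (observation X β w) (j + 1)} ≤
      ENNReal.ofReal (1 / L) + ENNReal.ofReal (1 / (M * n / 4)) := by
  have hn' : (0 : ℝ) < n := by exact_mod_cast hn
  have hfr : finrank ℝ (EuclideanSpace ℝ (Fin n)) = n := by simp
  rw [noiseLaw_eq_map, Measure.map_apply (by fun_prop)
    (measurableSet_lt measurable_const (by fun_prop))]
  have h1 := stdGaussian_le_norm_sq_le (E := EuclideanSpace ℝ (Fin n)) (by rwa [hfr]) hL
  have h2 := stdGaussian_le_inner_sq_le (norm_direction hX j) (c := M * n / 4) (by positivity)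
  refine (measure_mono fun z hz => ?_).trans ((measure_union_le _ _).trans (add_le_add h1 h2))
  by_contra hcon
  simp only [mem_union, mem_ofPred_eq, not_or, not_le, hfr] at hcon
  obtain ⟨hz1, hz2⟩ := hcon
  have hz' : x < residualRatio X (observation X β (σ • z)) (j + 1) := hz
  rw [residualRatio_succ hX, residual_observation hj.ge, inner_direction_observation hX hj,
    residual_smul, norm_smul, real_inner_smul_right, Real.norm_eq_abs, abs_of_pos hσ] at hz'
  set A := β j * ‖residual X j (column X j)‖
  set B := ⟪direction X j, z⟫
  set r := ‖residual X (j + 1) z‖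
  have hr : r ^ 2 ≤ L * n := by
    have : r ^ 2 ≤ ‖z‖ ^ 2 := pow_le_pow_left₀ (norm_nonneg _) (norm_residual_le _ _) 2
    linarith
  -- `s` bounds the signal amplitude `|A|` from below; the noise along the direction is at most `s /
  -- 2`, so at least half survives.
  set s := Real.sqrt (M * n) * σ with hs
  have hs0 : 0 < s := by positivity
  have hs2 : s ^ 2 = M * n * σ ^ 2 := by rw [hs, mul_pow, Real.sq_sqrt (by positivity)]
  have hA : s ≤ |A| := by
    refine le_of_sq_le_sq ?_ (abs_nonneg _)
    rw [le_div_iff₀ (by positivity)] at hsnr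
    rw [hs2, sq_abs, mul_pow, ← sq_abs (β j)]
    linarith
  have hB : |σ * B| ≤ s / 2 := by
    refine le_of_sq_le_sq ?_ (by positivity)
    rw [sq_abs, mul_pow, div_pow, hs2]
    nlinarith [sq_nonneg σ]
  have hAB : s / 2 ≤ |A + σ * B| := by
    have := abs_sub_abs_le_abs_sub A (-(σ * B))
    rw [abs_neg, sub_neg_eq_add] at this
    linarith
  have hAB2 : M * n * σ ^ 2 / 4 ≤ (A + σ * B) ^ 2 := by
    have := pow_le_pow_left₀ (by positivity) hAB 2
    rw [sq_abs, div_pow, hs2] at this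
    linarith
  have hU : 0 < (A + σ * B) ^ 2 := lt_of_lt_of_le (by positivity) hAB2
  rw [lt_div_iff₀ (by positivity)] at hz'
  have h3 : (1 - x) * (σ * r) ^ 2 ≤ x * (A + σ * B) ^ 2 := by
    have h4 : (1 - x) * (σ * r) ^ 2 ≤ (1 - x) * (σ ^ 2 * (L * n)) := by
      rw [mul_pow]
      have : 0 ≤ 1 - x := by linarith
      gcongr
    have h5 : (1 - x) * L * (σ ^ 2 * n) ≤ x * (M / 4) * (σ ^ 2 * n) := by gcongr
    have h6 : x * (M * n * σ ^ 2 / 4) ≤ x * (A + σ * B) ^ 2 := by gcongr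
    linarith
  linarith

end

/-! ### From crossings to under- and overestimation. -/

section

variable {n p : ℕ} {X : Matrix (Fin n) (Fin p) ℝ} {β : Fin p → ℝ}

theorem mem_crossings {y : EuclideanSpace ℝ (Fin n)} {α : ℝ} {k : ℕ} :
    k ∈ crossings X y α ↔ (1 ≤ k ∧ k ≤ p) ∧ residualRatio X y k ≤ threshold n p α k := by
  simp [crossings]

theorem estimate_eq_sup {y : EuclideanSpace ℝ (Fin n)} {α : ℝ} {k : ℕ}
    (hk : k ∈ crossings X y α) : estimate X α y = (crossings X y α).sup id := by
  rw [estimate, if_pos ⟨k, hk⟩]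

theorem le_estimate {y : EuclideanSpace ℝ (Fin n)} {α : ℝ} {k : ℕ}
    (hk : k ∈ crossings X y α) : k ≤ estimate X α y := by
  rw [estimate_eq_sup hk]
  exact Finset.le_sup (f := id) hk

theorem estimate_mem_crossings {y : EuclideanSpace ℝ (Fin n)} {α : ℝ} {k : ℕ}
    (hk : k ∈ crossings X y α) : estimate X α y ∈ crossings X y α := by
  rw [estimate_eq_sup hk]
  obtain ⟨i, hi, h⟩ := Finset.exists_mem_eq_sup _ ⟨k, hk⟩ id
  rw [h]
  exact hi

theorem modelOrder_le (β : Fin p → ℝ) : modelOrder β ≤ p :=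
  Finset.sup_le fun j _ => j.2

theorem modelOrder_pos (hβ : β ≠ 0) : 1 ≤ modelOrder β := by
  obtain ⟨j, hj⟩ := exists_succ_eq_modelOrder hβ
  omega

theorem threshold_lt_residualRatio_of_estimate_lt (hβ : β ≠ 0) {y : EuclideanSpace ℝ (Fin n)}
    {α : ℝ} (h : estimate X α y < modelOrder β) :
    threshold n p α (modelOrder β) < residualRatio X y (modelOrder β) := by
  by_contra! hle
  exact absurd h (le_estimate (mem_crossings.2
    ⟨⟨modelOrder_pos hβ, modelOrder_le β⟩, hle⟩)).not_gt

/-- The second term absorbs every outcome in which `alphaNew` is used. Otherwise the estimate is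
itself a crossing beyond `k₀`, and at most `p` indices each cost `α/p`. -/
theorem measure_modelOrder_lt_estimate_le (hX : X.rank = p) (hpn : p < n) {σ : ℝ} (hσ : 0 < σ)
    (hβ : β ≠ 0) {Ω : Type*} [MeasurableSpace Ω] {P : Measure Ω} {w : Ω → EuclideanSpace ℝ (Fin n)}
    (hw : HasLaw w (noiseLaw n σ) P) (α : ℝ) :
    P {ω | modelOrder β < estimate X α (observation X β (w ω))} ≤ ENNReal.ofReal α +
      P {ω | threshold n p α (modelOrder β) <
        residualRatio X (observation X β (w ω)) (modelOrder β)} := by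
  classical
  have hp : 0 < p := (modelOrder_pos hβ).trans (modelOrder_le β)
  set J : Finset (Fin p) := {j | modelOrder β ≤ (j : ℕ)}
  have hsub : {ω | modelOrder β < estimate X α (observation X β (w ω))} ⊆
      (⋃ j ∈ J, {ω | residualRatio X (observation X β (w ω)) (j + 1) ≤ threshold n p α (j + 1)}) ∪
      {ω | threshold n p α (modelOrder β) <
        residualRatio X (observation X β (w ω)) (modelOrder β)} := by
    intro ω hω
    have hω' : modelOrder β < estimate X α (observation X β (w ω)) := hω
    rcases lt_or_ge (threshold n p α (modelOrder β))
      (residualRatio X (observation X β (w ω)) (modelOrder β)) with h | h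
    · exact Or.inr h
    · left
      have hk := estimate_mem_crossings (mem_crossings.2
        ⟨⟨modelOrder_pos hβ, modelOrder_le β⟩, h⟩)
      rw [mem_crossings] at hk
      set k := estimate X α (observation X β (w ω))
      -- Orders count from 1, columns from 0.
      obtain ⟨j, hj⟩ : ∃ j : Fin p, (j : ℕ) + 1 = k := ⟨⟨k - 1, by omega⟩, by simp; omega⟩
      refine mem_biUnion (x := j) ?_ ?_
      · simp [J]
        omega
      · show residualRatio X _ ((j : ℕ) + 1) ≤ threshold n p α (j + 1)
        rw [hj]
        exact hk.2
  refine (measure_mono hsub).trans ((measure_union_le _ _).trans (add_le_add_left ?_ _))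
  calc P (⋃ j ∈ J, {ω | residualRatio X (observation X β (w ω)) (j + 1) ≤ threshold n p α (j + 1)})
      ≤ ∑ j ∈ J, P {ω | residualRatio X (observation X β (w ω)) (j + 1) ≤
          threshold n p α (j + 1)} := measure_biUnion_finset_le _ _
    _ ≤ ∑ j ∈ J, ENNReal.ofReal (α / p) := by
        refine Finset.sum_le_sum fun j hj => ?_
        have hj' : modelOrder β ≤ j := by simpa [J] using hj
        rw [hw.measure_eq (p := fun w => residualRatio X (observation X β w) (j + 1) ≤
          threshold n p α (j + 1)) (measurableSet_le (by fun_prop) measurable_const)]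
        exact noiseLaw_residualRatio_le_threshold hX hpn hσ hj' α
    _ ≤ p * ENNReal.ofReal (α / p) := by
        rw [Finset.sum_const, nsmul_eq_mul]
        gcongr
        exact_mod_cast (Finset.card_le_univ J).trans_eq (Fintype.card_fin p)
    _ = ENNReal.ofReal α := by
        rw [← ENNReal.ofReal_natCast, ← ENNReal.ofReal_mul (by positivity)]
        congr 1
        field_simp

end

/-! ### Asymptotics of the threshold and of the miss probability. -/

/-- Take logarithms and divide by `n`: the difference of the two sides tends to `(1 - klim)/2 * log
x < 0`. -/
theorem eventually_rpow_mul_lt {k : ℕ → ℕ} {klim : ℝ} (hklim : klim < 1)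
    (hk : Tendsto (fun n : ℕ => (k n : ℝ) / (n : ℝ)) atTop (𝓝 klim)) {α : ℕ → ℝ}
    (hα : ∀ᶠ n in atTop, 0 < α n)
    (hlog : Tendsto (fun n : ℕ => Real.log (α n) / (n : ℝ)) atTop (𝓝 0)) {x : ℝ} (hx : 0 < x)
    (hx1 : x < 1) (c : ℝ) :
    ∀ᶠ n : ℕ in atTop, x ^ (((n : ℝ) - k n) / 2) * (1 - x) ^ c < α n / n := by
  have hx2 : 0 < 1 - x := by linarith
  have hlogn : Tendsto (fun n : ℕ => Real.log n / (n : ℝ)) atTop (𝓝 0) :=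
    Real.isLittleO_log_id_atTop.tendsto_div_nhds_zero.comp tendsto_natCast_atTop_atTop
  have hc : Tendsto (fun n : ℕ => c * Real.log (1 - x) / (n : ℝ)) atTop (𝓝 0) :=
    tendsto_const_div_atTop_nhds_zero_nat _
  have hlim : Tendsto (fun n : ℕ => (1 - (k n : ℝ) / n) / 2 * Real.log x +
      c * Real.log (1 - x) / (n : ℝ) - Real.log (α n) / n + Real.log n / n) atTop
      (𝓝 ((1 - klim) / 2 * Real.log x + 0 - 0 + 0)) :=
    (((((hk.const_sub 1).div_const 2).mul_const _).add hc).sub hlog).add hlogn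
  have hneg : (1 - klim) / 2 * Real.log x + 0 - 0 + 0 < 0 := by
    have := Real.log_neg hx hx1
    nlinarith
  filter_upwards [hlim.eventually (gt_mem_nhds hneg), hα, eventually_gt_atTop 0] with n h hαn hn
  have hn' : (0 : ℝ) < n := by exact_mod_cast hn
  rw [← Real.log_lt_log_iff (by positivity) (by positivity), Real.log_mul (by positivity)
    (by positivity), Real.log_rpow hx, Real.log_rpow hx2, Real.log_div hαn.ne' hn'.ne']
  have h2 : ((1 - (k n : ℝ) / n) / 2 * Real.log x +
      c * Real.log (1 - x) / (n : ℝ) - Real.log (α n) / n + Real.log n / n) * n < 0 :=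
    mul_neg_of_neg_of_pos h hn'
  have h3 : ((1 - (k n : ℝ) / n) / 2 * Real.log x +
      c * Real.log (1 - x) / (n : ℝ) - Real.log (α n) / n + Real.log n / n) * n =
      ((n : ℝ) - k n) / 2 * Real.log x + c * Real.log (1 - x) - (Real.log (α n) - Real.log n) := by
    field_simp
    ring
  linarith

/-- Since `p < n`, the level `α/p` is at least `α/n`, which beats the exponentially small beta tail.
-/
theorem eventually_le_threshold {p k : ℕ → ℕ} {klim : ℝ} (hklim : klim < 1)
    (hk : Tendsto (fun n : ℕ => (k n : ℝ) / (n : ℝ)) atTop (𝓝 klim))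
    (hp0 : ∀ᶠ n in atTop, 0 < p n) (hkp : ∀ n, k n ≤ p n) (hpn : ∀ᶠ n in atTop, p n < n)
    {α : ℕ → ℝ} (hα : ∀ᶠ n in atTop, 0 < α n) (hα1 : ∀ᶠ n in atTop, α n ≤ 1)
    (hlog : Tendsto (fun n : ℕ => Real.log (α n) / (n : ℝ)) atTop (𝓝 0)) {x : ℝ} (hx : 0 < x)
    (hx1 : x < 1) : ∀ᶠ n in atTop, x ≤ threshold n (p n) (α n) (k n) := by
  filter_upwards [eventually_rpow_mul_lt hklim hk hα hlog hx hx1 (1 / 2 - 1), hp0, hpn, hα, hα1]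
    with n h hp hpn hα hα1
  have hp' : (1 : ℝ) ≤ p n := by exact_mod_cast hp
  have hpn' : (p n : ℝ) ≤ n := by exact_mod_cast hpn.le
  have hkn : (k n : ℝ) < n := by exact_mod_cast (hkp n).trans_lt hpn
  have ha : 0 < ((n : ℝ) - k n) / 2 := by linarith
  refine le_betaInvCDF ha (by norm_num) ((div_le_one (by linarith)).2 (by linarith)) ?_
  refine (betaMeasure_Iic_le ha (by norm_num) (by norm_num) hx hx1).trans_lt ?_
  refine (ENNReal.ofReal_lt_ofReal_iff (by positivity)).2 (h.trans_le ?_)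
  gcongr

/-- The residual ratio at the model order exceeds its threshold with vanishing probability. -/
theorem tendsto_measure_threshold_lt_residualRatio
    {p : ℕ → ℕ} {X : ∀ n, Matrix (Fin n) (Fin (p n)) ℝ} {β : ∀ n, Fin (p n) → ℝ} {σ : ℕ → ℝ}
    {Ω : ℕ → Type*} [∀ n, MeasurableSpace (Ω n)] {P : ∀ n, Measure (Ω n)}
    {w : ∀ n, Ω n → EuclideanSpace ℝ (Fin n)}
    (hw : ∀ᶠ n in atTop, HasLaw (w n) (noiseLaw n (σ n)) (P n))
    (hσ : ∀ᶠ n in atTop, 0 < σ n) (hp : ∀ᶠ n in atTop, p n < n)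
    (hX : ∀ᶠ n in atTop, (X n).rank = p n) (hβ : ∀ᶠ n in atTop, β n ≠ 0)
    {klim : ℝ} (hklim : klim < 1)
    (hk : Tendsto (fun n : ℕ => (modelOrder (β n) : ℝ) / (n : ℝ)) atTop (𝓝 klim))
    (hsnr : ∃ M₁ : ℝ, 0 < M₁ ∧ ∃ n₀ : ℕ, ∀ n > n₀, ∀ j : Fin (p n),
      (j : ℕ) + 1 = modelOrder (β n) →
        M₁ * (n : ℝ) ≤ ‖residual (X n) (modelOrder (β n) - 1) (column (X n) j)‖ ^ 2
          * |β n j| ^ 2 / σ n ^ 2)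
    {α : ℕ → ℝ} (hα : ∀ᶠ n in atTop, 0 < α n) (hα1 : ∀ᶠ n in atTop, α n ≤ 1)
    (hlog : Tendsto (fun n : ℕ => Real.log (α n) / (n : ℝ)) atTop (𝓝 0)) :
    Tendsto (fun n : ℕ => P n {ω | threshold n (p n) (α n) (modelOrder (β n)) <
      residualRatio (X n) (observation (X n) (β n) (w n ω)) (modelOrder (β n))}) atTop (𝓝 0) := by
  obtain ⟨M, hM, n₀, hsnr⟩ := hsnr
  have hp0 : ∀ᶠ n in atTop, 0 < p n := hβ.mono fun n h =>
    (modelOrder_pos h).trans (modelOrder_le _)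
  have key : ∀ L : ℝ, 0 < L → ∀ᶠ n : ℕ in atTop,
      P n {ω | threshold n (p n) (α n) (modelOrder (β n)) <
        residualRatio (X n) (observation (X n) (β n) (w n ω)) (modelOrder (β n))} ≤
      ENNReal.ofReal (1 / L) + ENNReal.ofReal (1 / (M * n / 4)) := by
    intro L hL
    -- This `x` solves `(1 - x) L = x M / 4`, the smallest value the ratio bound allows.
    have hx : 0 < L / (L + M / 4) := by positivity
    have hx1 : L / (L + M / 4) < 1 := (div_lt_one (by positivity)).2 (by linarith)
    have hLx : (1 - L / (L + M / 4)) * L ≤ L / (L + M / 4) * (M / 4) := by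
      refine le_of_eq ?_
      field_simp
      ring
    filter_upwards [hw, hσ, hX, hβ, eventually_gt_atTop n₀, eventually_le_threshold hklim hk hp0
      (fun n => modelOrder_le _) hp hα hα1 hlog hx hx1] with n hw hσ hX hβ hn hthr
    obtain ⟨j, hj⟩ := exists_succ_eq_modelOrder hβ
    have hs := hsnr n hn j hj
    rw [← hj, Nat.add_sub_cancel] at hs
    refine le_trans ?_ (noiseLaw_lt_residualRatio_le hX hσ hj hM hL hx hx1 hLx (by omega) hs)
    rw [← hw.measure_eq (measurableSet_lt measurable_const (by fun_prop))]
    refine measure_mono fun ω hω => ?_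
    have hω' : threshold n (p n) (α n) (modelOrder (β n)) <
      residualRatio (X n) (observation (X n) (β n) (w n ω)) (modelOrder (β n)) := hω
    show L / (L + M / 4) < residualRatio (X n) (observation (X n) (β n) (w n ω)) (j + 1)
    rw [hj]
    exact hthr.trans_lt hω'
  have hlim : Tendsto (fun n : ℕ => ENNReal.ofReal (1 / (M * n / 4))) atTop (𝓝 0) := by
    rw [← ENNReal.ofReal_zero]
    refine ENNReal.tendsto_ofReal ?_
    have h := tendsto_const_div_atTop_nhds_zero_nat (4 / M)
    refine h.congr fun n => ?_
    field_simp
  rw [ENNReal.tendsto_nhds_zero]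
  intro ε hε
  obtain ⟨δ, hδ, hδε⟩ := ENNReal.lt_iff_exists_nnreal_btwn.1 hε
  have hδ0 : (0 : ℝ) < δ := by exact_mod_cast hδ
  -- With `L = 2/δ` the term independent of `n` equals `δ/2`.
  filter_upwards [key (2 / δ) (by positivity), (ENNReal.tendsto_nhds_zero.1 hlim)
    (ENNReal.ofReal (δ / 2)) (by simpa using hδ0)] with n h1 h2
  calc _ ≤ _ := h1
    _ ≤ ENNReal.ofReal (δ / 2) + ENNReal.ofReal (δ / 2) := by
        rw [one_div_div]
        gcongr
    _ = δ := by
        rw [← ENNReal.ofReal_add (by positivity) (by positivity), add_halves,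
          ENNReal.ofReal_coe_nnreal]
    _ ≤ ε := hδε.le

/-- The total mass of `P` is read off from the law of the noise. -/
theorem isProbabilityMeasure_of_hasLaw_noiseLaw {n : ℕ} {σ : ℝ} {Ω : Type*} [MeasurableSpace Ω]
    {P : Measure Ω} {w : Ω → EuclideanSpace ℝ (Fin n)} (hw : HasLaw w (noiseLaw n σ) P) :
    IsProbabilityMeasure P := by
  have : IsProbabilityMeasure (noiseLaw n σ) := by unfold noiseLaw; infer_instance
  constructor
  simpa using hw.measure_eq (p := fun _ => True) (by simp)

end RRT

/-! ### The consistency theorem. -/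

theorem theorem5
    -- for every sample size `n`: number of columns, design matrix, regression vector, noise level
    (p : ℕ → ℕ) (X : ∀ n, Matrix (Fin n) (Fin (p n)) ℝ) (β : ∀ n, Fin (p n) → ℝ) (σ : ℕ → ℝ)
    -- Gaussian noise
    {Ω : ℕ → Type*} [∀ n, MeasurableSpace (Ω n)] (P : ∀ n, MeasureTheory.Measure (Ω n))
    (w : ∀ n, Ω n → EuclideanSpace ℝ (Fin n))
    (hw : ∀ᶠ n in Filter.atTop, ProbabilityTheory.HasLaw (w n) (RRT.noiseLaw n (σ n)) (P n))
    (hσ : ∀ᶠ n in Filter.atTop, 0 < σ n)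
    (hp : ∀ᶠ n in Filter.atTop, p n < n)
    (hX : ∀ᶠ n in Filter.atTop, (X n).rank = p n)
    (hβ : ∀ᶠ n in Filter.atTop, β n ≠ 0)
    -- a)
    (klim : ℝ) (hklim : klim < 1)
    (hk : Filter.Tendsto (fun n : ℕ => (RRT.modelOrder (β n) : ℝ) / (n : ℝ)) Filter.atTop
      (nhds klim))
    -- b)
    (hsnr : ∃ M₁ : ℝ, 0 < M₁ ∧ ∃ n₀ : ℕ, ∀ n > n₀, ∀ j : Fin (p n),
      (j : ℕ) + 1 = RRT.modelOrder (β n) →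
        M₁ * (n : ℝ) ≤ ‖RRT.residual (X n) (RRT.modelOrder (β n) - 1) (RRT.column (X n) j)‖ ^ 2
          * |β n j| ^ 2 / σ n ^ 2) :
    -- R1)
    (∀ α : ℕ → ℝ, (∀ᶠ n in Filter.atTop, 0 < α n) →
      Filter.Tendsto (fun n : ℕ => Real.log (α n) / (n : ℝ)) Filter.atTop (nhds 0) →
      Filter.Tendsto α Filter.atTop (nhds 0) →
      Filter.Tendsto (fun n : ℕ => (P n).real {ω : Ω n |
          RRT.estimate (X n) (α n) (RRT.observation (X n) (β n) (w n ω))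
            = RRT.modelOrder (β n)})
        Filter.atTop (nhds 1)) ∧
    -- R2)
    (∀ α : ℝ, 0 < α → α ≤ 1 →
      Filter.Tendsto (fun n : ℕ => (P n).real {ω : Ω n |
          RRT.estimate (X n) α (RRT.observation (X n) (β n) (w n ω))
            < RRT.modelOrder (β n)})
        Filter.atTop (nhds 0) ∧
      Filter.limsup (fun n : ℕ => (P n).real {ω : Ω n |
          RRT.modelOrder (β n)
            < RRT.estimate (X n) α (RRT.observation (X n) (β n) (w n ω))})
        Filter.atTop ≤ α) := by
  have hP := hw.mono fun n h => RRT.isProbabilityMeasure_of_hasLaw_noiseLaw h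
  let miss : (ℕ → ℝ) → ∀ n, Set (Ω n) := fun α n =>
    {ω | RRT.threshold n (p n) (α n) (RRT.modelOrder (β n)) <
      RRT.residualRatio (X n) (RRT.observation (X n) (β n) (w n ω)) (RRT.modelOrder (β n))}
  have hmiss0 : ∀ α : ℕ → ℝ, (∀ᶠ n in atTop, 0 < α n) → (∀ᶠ n in atTop, α n ≤ 1) →
      Tendsto (fun n : ℕ => Real.log (α n) / (n : ℝ)) atTop (nhds 0) →
      Tendsto (fun n => (P n).real (miss α n)) atTop (nhds 0) := fun α h1 h2 h3 => by
    exact (ENNReal.tendsto_toReal ENNReal.zero_ne_top).comp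
      (RRT.tendsto_measure_threshold_lt_residualRatio hw hσ hp hX hβ hklim hk hsnr h1 h2 h3)
  have hunder : ∀ α : ℕ → ℝ, ∀ᶠ n in atTop, (P n).real {ω : Ω n |
      RRT.estimate (X n) (α n) (RRT.observation (X n) (β n) (w n ω)) < RRT.modelOrder (β n)} ≤
      (P n).real (miss α n) := by
    intro α
    filter_upwards [hβ, hP] with n hβ hP
    exact measureReal_mono fun ω hω => RRT.threshold_lt_residualRatio_of_estimate_lt hβ hω
  have hover : ∀ α : ℕ → ℝ, (∀ᶠ n in atTop, 0 < α n) → ∀ᶠ n in atTop, (P n).real {ω : Ω n |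
      RRT.modelOrder (β n) < RRT.estimate (X n) (α n) (RRT.observation (X n) (β n) (w n ω))} ≤
      α n + (P n).real (miss α n) := by
    intro α hα
    filter_upwards [hw, hσ, hp, hX, hβ, hP, hα] with n hw hσ hp hX hβ hP hα
    have h := RRT.measure_modelOrder_lt_estimate_le hX hp hσ hβ hw (α n)
    rw [measureReal_def, measureReal_def, ← ENNReal.toReal_ofReal hα.le,
      ← ENNReal.toReal_add ENNReal.ofReal_ne_top (measure_ne_top _ _),
      ENNReal.toReal_ofReal hα.le]
    exact ENNReal.toReal_mono (by finiteness) h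
  refine ⟨fun α hα hlog hα0 => ?_, fun α hα hα1 => ?_⟩
  · have hm := hmiss0 α hα (hα0.eventually (ge_mem_nhds one_pos)) hlog
    -- Lower bound for `PCS`: one minus the bounds for under- and overestimation.
    have hlow : Tendsto (fun n => 1 - ((P n).real (miss α n) + (α n + (P n).real (miss α n))))
        atTop (nhds 1) := by
      simpa using (hm.add (hα0.add hm)).const_sub 1
    refine tendsto_of_tendsto_of_tendsto_of_le_of_le' hlow tendsto_const_nhds ?_ ?_
    · filter_upwards [hunder α, hover α hα, hP] with n h1 h2 hP
      set e : Ω n → ℕ := fun ω =>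
        RRT.estimate (X n) (α n) (RRT.observation (X n) (β n) (w n ω))
      set k := RRT.modelOrder (β n)
      have hcover : (univ : Set (Ω n)) ⊆ {ω | e ω = k} ∪ ({ω | e ω < k} ∪ {ω | k < e ω}) := by
        intro ω _
        rcases lt_trichotomy (e ω) k with h | h | h
        · exact Or.inr (Or.inl h)
        · exact Or.inl h
        · exact Or.inr (Or.inr h)
      have h3 : (1 : ℝ) ≤ _ := (probReal_univ (μ := P n)).symm.le.trans
        ((measureReal_mono hcover).trans (measureReal_union_le _ _))
      have h4 := measureReal_union_le (μ := P n) {ω | e ω < k} {ω | k < e ω}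
      linarith
    · filter_upwards [hP] with n hP
      exact measureReal_le_one
  · have hm := hmiss0 (fun _ => α) (Eventually.of_forall fun _ => hα)
      (Eventually.of_forall fun _ => hα1) (tendsto_const_div_atTop_nhds_zero_nat _)
    refine ⟨tendsto_of_tendsto_of_tendsto_of_le_of_le' tendsto_const_nhds hm
      (Eventually.of_forall fun _ => measureReal_nonneg) (hunder fun _ => α), ?_⟩
    refine le_of_forall_pos_le_add fun ε hε => ?_
    -- A real `limsup` needs a bound from below to be meaningful; nonnegativity provides it.
    refine limsup_le_of_le (isCoboundedUnder_le_of_le atTop (x := 0) fun _ => measureReal_nonneg) ?_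
    filter_upwards [hover (fun _ => α) (Eventually.of_forall fun _ => hα),
      hm.eventually (ge_mem_nhds hε)] with n h1 h2
    linarith
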